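/- Let $m,n\ge 1$, let $A,X\in\mathbb{M}_{m\times n}(\mathbb{C})$ with $A\neq 0$, let $2\le p<\infty$ be real and let $k$ be an integer with $1\le k\le \min\{m,n\}$. Let $\sigma_1(A)\ge\sigma_2(A)\ge\cdots\ge\sigma_{\min\{m,n\}}(A)\geq 0$ be the singular values of $A$ and let $\|A\|_{(p,k)}=\left(\sigma_1^p(A)+\cdots+\sigma_k^p(A)\right)^{1/p}$ be the Ky Fan $p$-$k$ norm. Then the right-hand directional derivative $$D^+\|A\|_{(p,k)}(X)=\lim_{t\to 0^+}\frac{\|A+tX\|_{(p,k)}-\|A\|_{(p,k)}}{t}$$ exists and $$D^+\|A\|_{(p,k)}(X)=\max\left\{\frac{1}{\|A\|_{(p,k)}^{p-1}}\sum_{i=1}^{k}\sigma_i^{p-2}(A)\,\operatorname{Re}\langle Av_i,Xv_i\rangle \;:\; v_1,\ldots,v_k\in\mathbb{C}^n \text{ orthonormal},\ A^*Av_i=\sigma_i^2(A)v_i\ \text{for } 1\le i\le k\right\},$$ the maximum being attained (with $0^0=1$ when $p=2$ and $\sigma_i(A)=0$; the corresponding term vanishes in any case because then $Av_i=0$). 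-/

import Mathlib

open Filter Topology
open scoped Matrix

/-- The singular values of a complex `m × n` matrix in non-increasing order, indexed from `0`:
`singularValue A i` is `σ_{i+1}(A)`.  It is the square root of the `(i+1)`-st largest eigenvalue
of `Aᴴ * A`, counted with multiplicity (and `0` for `i ≥ n`). -/
noncomputable def singularValue {m n : ℕ} (A : Matrix (Fin m) (Fin n) ℂ) (i : ℕ) : ℝ :=
  (Matrix.toEuclideanLin A).singularValues i

/-- The Ky Fan `p`-`k` norm `(σ_1(A)^p + ⋯ + σ_k(A)^p)^(1/p)`. -/
noncomputable def kyFanNorm {m n : ℕ} (p : ℝ) (k : ℕ) (A : Matrix (Fin m) (Fin n) ℂ) : ℝ :=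
  (∑ i : Fin k, singularValue A i ^ p) ^ (1 / p)

/-- `d` is the right hand directional derivative of the Ky Fan `p`-`k` norm at `A` in the
direction `X`: the limit defining it exists and equals `d`. -/
def HasRightDirDerivKyFan {m n : ℕ} (p : ℝ) (k : ℕ) (A X : Matrix (Fin m) (Fin n) ℂ)
    (d : ℝ) : Prop :=
  Tendsto (fun t : ℝ => (kyFanNorm p k (A + (t : ℂ) • X) - kyFanNorm p k A) / t)
    (𝓝[>] (0 : ℝ)) (𝓝 d)

/-- `v_1, …, v_k` are orthonormal vectors of `ℂⁿ` with `Aᴴ A v_i = σ_i(A)² v_i` for all `i`. -/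
def IsTopRightSingularFamily {m n k : ℕ} (A : Matrix (Fin m) (Fin n) ℂ)
    (v : Fin k → EuclideanSpace ℂ (Fin n)) : Prop :=
  Orthonormal ℂ v ∧
    ∀ i : Fin k, Matrix.toEuclideanLin (Aᴴ * A) (v i) = ((singularValue A i ^ 2 : ℝ) : ℂ) • v i

/-!
The idea is an envelope argument. By Jensen's inequality and Bessel's inequality, the power sum
`Φ(T) = σ_1(T)^p + ⋯ + σ_k(T)^p` is the maximum of `∑ ‖T v_i‖^p` over orthonormal families, attained
at every family of right singular vectors for the largest singular values. Since `T ↦ ‖T x‖^p` is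
convex, each such family `v` yields the subgradient `S ↦ p ∑ σ_i(T)^(p-2) Re ⟪T v_i, S v_i⟫` of `Φ`
at `T`. The families in question form a compact set whose graph over `T` is closed, because singular
values depend continuously on `T`. The subgradient inequality at `A` then bounds the difference
quotients of `Φ` from below, and the one at `A + tX` bounds them from above by a slope which, by
compactness, is asymptotically at most the largest slope at `A`.
-/

section Envelope

theorem eventually_forall_mem_lt_of_isCompact {Y X : Type*} [TopologicalSpace Y]
    [TopologicalSpace X] {K : Set X} (hK : IsCompact K) {M : Set (Y × X)} (hM : IsClosed M)
    {g : Y × X → ℝ} (hg : Continuous g) {y₀ : Y} {a : ℝ} (ha : ∀ x, (y₀, x) ∈ M → g (y₀, x) < a) :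
    ∀ᶠ y in 𝓝 y₀, ∀ x ∈ K, (y, x) ∈ M → g (y, x) < a := by
  have hopen : IsOpen {q | q ∈ M → g q < a} := by
    simpa only [imp_iff_not_or] using! hM.isOpen_compl.union (isOpen_lt hg continuous_const)
  exact hK.eventually_forall_of_forall_eventually fun x _ => hopen.mem_nhds (ha x)

theorem exists_isGreatest_hasDerivWithinAt_Ioi_of_subgradient {X : Type*} [TopologicalSpace X]
    {K : Set X} (hK : IsCompact K) {M : Set (ℝ × X)} (hM : IsClosed M) (hMK : ∀ q ∈ M, q.2 ∈ K)
    (hne : ∀ t, ∃ x, (t, x) ∈ M) {f : ℝ → ℝ} {g : ℝ × X → ℝ} (hg : Continuous g)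
    (hsub : ∀ q ∈ M, ∀ s, f q.1 + (s - q.1) * g q ≤ f s) (t₀ : ℝ) :
    ∃ d, IsGreatest ((fun x => g (t₀, x)) '' {x | (t₀, x) ∈ M}) d ∧
      HasDerivWithinAt f d (Set.Ioi t₀) t₀ := by
  have hfiber : IsCompact {x | (t₀, x) ∈ M} :=
    hK.of_isClosed_subset (hM.preimage (by fun_prop)) fun x hx => hMK _ hx
  obtain ⟨d, hd⟩ := (hfiber.image (f := fun x => g (t₀, x)) (by fun_prop)).exists_isGreatest
    (Set.Nonempty.image _ (hne t₀))
  refine ⟨d, hd, ?_⟩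
  rw [hasDerivWithinAt_iff_tendsto_slope' Set.self_notMem_Ioi, tendsto_order]
  refine ⟨fun a had => ?_, fun a hda => ?_⟩
  · obtain ⟨x, hx, rfl⟩ := hd.1
    filter_upwards [self_mem_nhdsWithin] with t (ht : t₀ < t)
    refine had.trans_le ?_
    rw [slope_def_field, le_div_iff₀ (sub_pos.2 ht)]
    linarith [hsub _ hx t]
  · have hlt : ∀ x, (t₀, x) ∈ M → g (t₀, x) < a := fun x hx => (hd.2 ⟨x, hx, rfl⟩).trans_lt hda
    filter_upwards [self_mem_nhdsWithin,
      nhdsWithin_le_nhds (eventually_forall_mem_lt_of_isCompact hK hM hg hlt)]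
      with t (ht : t₀ < t) htM
    obtain ⟨x, hx⟩ := hne t
    refine lt_of_le_of_lt ?_ (htM x (hMK _ hx) hx)
    rw [slope_def_field, div_le_iff₀ (sub_pos.2 ht)]
    linarith [hsub _ hx t₀]

end Envelope

section Tangent

theorem rpow_add_mul_sub_le_rpow {p a b : ℝ} (hp : 1 ≤ p) (ha : 0 ≤ a) (hb : 0 ≤ b) :
    a ^ p + p * a ^ (p - 1) * (b - a) ≤ b ^ p := by
  rcases hp.eq_or_lt with rfl | hp
  · simp
  rcases ha.eq_or_lt with rfl | ha
  · rw [Real.zero_rpow (by linarith), Real.zero_rpow (by linarith)]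
    simpa using Real.rpow_nonneg hb p
  · have bernoulli := one_add_mul_self_le_rpow_one_add (s := b / a - 1)
      (by linarith [div_nonneg hb ha.le]) hp.le
    rw [add_sub_cancel, Real.div_rpow hb ha.le, le_div_iff₀ (by positivity)] at bernoulli
    refine le_of_eq_of_le ?_ bernoulli
    rw [Real.rpow_sub_one ha.ne']
    field_simp

theorem norm_rpow_add_mul_re_inner_le {𝕜 F : Type*} [RCLike 𝕜] [NormedAddCommGroup F]
    [InnerProductSpace 𝕜 F] {p : ℝ} (hp : 1 ≤ p) (x h : F) :
    ‖x‖ ^ p + p * (‖x‖ ^ (p - 2) * RCLike.re (inner 𝕜 x h)) ≤ ‖x + h‖ ^ p := by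
  rcases eq_or_ne x 0 with rfl | hx
  · simpa [Real.zero_rpow (by linarith : p ≠ 0)] using Real.rpow_nonneg (norm_nonneg h) p
  have hinner : RCLike.re (inner 𝕜 x h) ≤ ‖x‖ * (‖x + h‖ - ‖x‖) := by
    have cauchy_schwarz := re_inner_le_norm (𝕜 := 𝕜) x (x + h)
    rw [inner_add_right, map_add, inner_self_eq_norm_sq] at cauchy_schwarz
    linarith
  calc ‖x‖ ^ p + p * (‖x‖ ^ (p - 2) * RCLike.re (inner 𝕜 x h))
      ≤ ‖x‖ ^ p + p * (‖x‖ ^ (p - 2) * (‖x‖ * (‖x + h‖ - ‖x‖))) := by gcongr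
    _ = ‖x‖ ^ p + p * ‖x‖ ^ (p - 1) * (‖x + h‖ - ‖x‖) := by
      rw [show p - 1 = p - 2 + 1 by ring, Real.rpow_add_one (norm_ne_zero_iff.2 hx)]
      ring
    _ ≤ ‖x + h‖ ^ p := rpow_add_mul_sub_le_rpow hp (norm_nonneg x) (norm_nonneg (x + h))

end Tangent

theorem sum_mul_le_sum_castLE_of_antitone {n k : ℕ} (hk : k ≤ n) {a w : Fin n → ℝ}
    (ha : Antitone a) (hw0 : ∀ j, 0 ≤ w j) (hw1 : ∀ j, w j ≤ 1) (hw : ∑ j, w j = k) :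
    ∑ j, w j * a j ≤ ∑ i, a (Fin.castLE hk i) := by
  obtain ⟨l, rfl⟩ := Nat.exists_eq_add_of_le hk
  obtain ⟨c, hc_head, hc_tail⟩ : ∃ c, (∀ i : Fin k, c ≤ a (Fin.castAdd l i)) ∧
      ∀ j : Fin l, a (Fin.natAdd k j) ≤ c := by
    cases k with
    | zero =>
      obtain ⟨c, hc⟩ := (Set.finite_range fun j : Fin l => a (Fin.natAdd 0 j)).bddAbove
      exact ⟨c, fun i => i.elim0, fun j => hc ⟨j, rfl⟩⟩
    | succ k =>
      refine ⟨a (Fin.castAdd l (Fin.last k)), fun i => ha ?_, fun j => ha ?_⟩ <;>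
        simp only [Fin.le_def, Fin.val_castAdd, Fin.val_natAdd, Fin.val_last] <;> omega
  have head : ∑ i : Fin k, (1 - w (Fin.castAdd l i)) * c ≤
      ∑ i : Fin k, (1 - w (Fin.castAdd l i)) * a (Fin.castAdd l i) :=
    Finset.sum_le_sum fun i _ => mul_le_mul_of_nonneg_left (hc_head i) (sub_nonneg.2 (hw1 _))
  have tail : ∑ j : Fin l, w (Fin.natAdd k j) * a (Fin.natAdd k j) ≤
      ∑ j : Fin l, w (Fin.natAdd k j) * c :=
    Finset.sum_le_sum fun j _ => mul_le_mul_of_nonneg_left (hc_tail j) (hw0 _)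
  have mass : ∑ j : Fin l, w (Fin.natAdd k j) = ∑ i : Fin k, (1 - w (Fin.castAdd l i)) := by
    rw [Fin.sum_univ_add] at hw
    simp only [Finset.sum_sub_distrib, Finset.sum_const, Finset.card_univ, Fintype.card_fin,
      nsmul_eq_mul, mul_one]
    linarith
  rw [← Finset.sum_mul, ← mass, Finset.sum_mul] at head
  have hbound := tail.trans head
  simp only [sub_mul, one_mul, Finset.sum_sub_distrib] at hbound
  rw [Fin.sum_univ_add]
  exact le_sub_iff_add_le'.1 hbound

section SymmetricOperator

variable {𝕜 E : Type*} [RCLike 𝕜] [NormedAddCommGroup E] [InnerProductSpace 𝕜 E]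

theorem re_inner_apply_self_eq_sum_eigenvalues [FiniteDimensional 𝕜 E] {A : E →ₗ[𝕜] E}
    (hA : A.IsSymmetric) {n : ℕ} (hn : Module.finrank 𝕜 E = n) (x : E) :
    RCLike.re (inner 𝕜 (A x) x) =
      ∑ j, ‖inner 𝕜 (hA.eigenvectorBasis hn j) x‖ ^ 2 * hA.eigenvalues hn j := by
  set b := hA.eigenvectorBasis hn with hb
  rw [← b.sum_inner_mul_inner, map_sum]
  refine Finset.sum_congr rfl fun j _ => ?_
  rw [hA, hA.apply_eigenvectorBasis hn, inner_smul_right, mul_assoc, RCLike.re_ofReal_mul,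
    ← hb, inner_mul_symm_re_eq_norm, norm_mul, norm_inner_symm x]
  ring

theorem sum_sum_norm_inner_sq_eq_card {ι κ : Type*} [Fintype ι] [Fintype κ]
    (b : OrthonormalBasis ι 𝕜 E) {v : κ → E} (hv : ∀ i, ‖v i‖ = 1) :
    ∑ j, ∑ i, ‖inner 𝕜 (b j) (v i)‖ ^ 2 = Fintype.card κ := by
  rw [Finset.sum_comm]
  simp [b.sum_sq_norm_inner_right, hv]

theorem sum_map_re_inner_le_sum_map_eigenvalues [FiniteDimensional 𝕜 E] {A : E →ₗ[𝕜] E}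
    (hA : A.IsSymmetric) {n : ℕ} (hn : Module.finrank 𝕜 E = n) {φ : ℝ → ℝ} {s : Set ℝ}
    (hφ : ConvexOn ℝ s φ) (hφ_mono : MonotoneOn φ s) (hs : ∀ j, hA.eigenvalues hn j ∈ s)
    {k : ℕ} (hk : k ≤ n) {v : Fin k → E} (hv : Orthonormal 𝕜 v) :
    ∑ i, φ (RCLike.re (inner 𝕜 (A (v i)) (v i))) ≤
      ∑ i, φ (hA.eigenvalues hn (Fin.castLE hk i)) := by
  set b := hA.eigenvectorBasis hn
  have jensen : ∀ i, φ (RCLike.re (inner 𝕜 (A (v i)) (v i))) ≤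
      ∑ j, ‖inner 𝕜 (b j) (v i)‖ ^ 2 * φ (hA.eigenvalues hn j) := fun i => by
    rw [re_inner_apply_self_eq_sum_eigenvalues hA hn]
    exact hφ.map_sum_le (fun _ _ => by positivity)
      (by rw [b.sum_sq_norm_inner_right, hv.1 i, one_pow]) fun j _ => hs j
  have bessel : ∀ j, ∑ i, ‖inner 𝕜 (b j) (v i)‖ ^ 2 ≤ 1 := fun j => by
    simpa [norm_inner_symm, b.orthonormal.1 j] using
      hv.sum_inner_products_le (b j) (s := Finset.univ)
  calc ∑ i, φ (RCLike.re (inner 𝕜 (A (v i)) (v i)))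
      ≤ ∑ i, ∑ j, ‖inner 𝕜 (b j) (v i)‖ ^ 2 * φ (hA.eigenvalues hn j) :=
        Finset.sum_le_sum fun i _ => jensen i
    _ = ∑ j, (∑ i, ‖inner 𝕜 (b j) (v i)‖ ^ 2) * φ (hA.eigenvalues hn j) := by
        rw [Finset.sum_comm]
        simp only [Finset.sum_mul]
    _ ≤ ∑ i, φ (hA.eigenvalues hn (Fin.castLE hk i)) :=
        sum_mul_le_sum_castLE_of_antitone hk
          (fun i j hij => hφ_mono (hs j) (hs i) (hA.eigenvalues_antitone hn hij))
          (fun j => by positivity) bessel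
          (by rw [sum_sum_norm_inner_sq_eq_card b hv.1, Fintype.card_fin])

variable (𝕜 E) in
theorem isCompact_setOf_orthonormal [FiniteDimensional 𝕜 E] (ι : Type*) :
    IsCompact {v : ι → E | Orthonormal 𝕜 v} := by
  classical
  have := FiniteDimensional.proper_rclike 𝕜 E
  refine (isCompact_univ_pi fun _ : ι => isCompact_sphere (0 : E) 1).of_isClosed_subset ?_
    fun v hv i _ => by simpa using hv.1 i
  simp only [orthonormal_iff_ite, Set.ofPred_forall]
  exact isClosed_iInter fun i => isClosed_iInter fun j =>
    isClosed_eq (by fun_prop) continuous_const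

end SymmetricOperator

section SingularValues

variable {𝕜 E F : Type*} [RCLike 𝕜] [NormedAddCommGroup E] [InnerProductSpace 𝕜 E]
  [FiniteDimensional 𝕜 E] [NormedAddCommGroup F] [InnerProductSpace 𝕜 F] [FiniteDimensional 𝕜 F]

/-- An orthonormal family of right singular vectors of `T`, the `i`-th one for the `i`-th largest
singular value. -/
def IsTopSingularFamily {k : ℕ} (T : E →ₗ[𝕜] F) (v : Fin k → E) : Prop :=
  Orthonormal 𝕜 v ∧
    ∀ i : Fin k, LinearMap.adjoint T (T (v i)) = ((T.singularValues i ^ 2 : ℝ) : 𝕜) • v i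

/-- The sum of the `p`-th powers of the `k` largest singular values, that is, the `p`-th power of
the Ky Fan `p`-`k` norm. -/
noncomputable def kyFanPowerSum (p : ℝ) (k : ℕ) (T : E →ₗ[𝕜] F) : ℝ :=
  ∑ i : Fin k, T.singularValues i ^ p

/-- The slope in the direction `S` of the subgradient of `kyFanPowerSum p k` at `T` given by a
family `v` of singular vectors, up to a factor `p`. -/
noncomputable def kyFanSlope (p : ℝ) {k : ℕ} (T S : E →ₗ[𝕜] F) (v : Fin k → E) : ℝ :=
  ∑ i : Fin k, T.singularValues i ^ (p - 2) * RCLike.re (inner 𝕜 (T (v i)) (S (v i)))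

theorem exists_isTopSingularFamily (T : E →ₗ[𝕜] F) {k : ℕ} (hk : k ≤ Module.finrank 𝕜 E) :
    ∃ v : Fin k → E, IsTopSingularFamily T v := by
  have hT := T.isSymmetric_adjoint_comp_self
  refine ⟨fun i => hT.eigenvectorBasis rfl (Fin.castLE hk i),
    (hT.eigenvectorBasis rfl).orthonormal.comp _ (Fin.castLE_injective hk), fun i => ?_⟩
  have heig := hT.apply_eigenvectorBasis rfl (Fin.castLE hk i)
  rwa [← T.sq_singularValues_fin rfl] at heig

theorem isTopSingularFamily_iff_inner {k : ℕ} {T : E →ₗ[𝕜] F} {v : Fin k → E} :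
    IsTopSingularFamily T v ↔ Orthonormal 𝕜 v ∧ ∀ (i : Fin k) (x : E),
      inner 𝕜 (T x) (T (v i)) = ((T.singularValues i ^ 2 : ℝ) : 𝕜) * inner 𝕜 x (v i) := by
  refine and_congr_right fun _ => forall_congr' fun i => ?_
  rw [ext_iff_inner_left 𝕜]
  simp only [LinearMap.adjoint_inner_right, inner_smul_right]

theorem IsTopSingularFamily.norm_apply {k : ℕ} {T : E →ₗ[𝕜] F} {v : Fin k → E}
    (hv : IsTopSingularFamily T v) (i : Fin k) : ‖T (v i)‖ = T.singularValues i := by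
  have hsq := (isTopSingularFamily_iff_inner.1 hv).2 i (v i)
  rw [inner_self_eq_norm_sq_to_K, inner_self_eq_norm_sq_to_K, hv.1.1 i, RCLike.ofReal_one,
    one_pow, mul_one] at hsq
  exact (sq_eq_sq₀ (norm_nonneg _) (T.singularValues_nonneg i)).1 (by exact_mod_cast hsq)

theorem IsTopSingularFamily.sum_norm_apply_rpow {k : ℕ} {T : E →ₗ[𝕜] F} {v : Fin k → E}
    (hv : IsTopSingularFamily T v) (p : ℝ) : ∑ i, ‖T (v i)‖ ^ p = kyFanPowerSum p k T :=
  Finset.sum_congr rfl fun i _ => by rw [hv.norm_apply i]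

theorem sum_norm_apply_rpow_le_kyFanPowerSum (T : E →ₗ[𝕜] F) {p : ℝ} (hp : 2 ≤ p) {k : ℕ}
    {v : Fin k → E} (hv : Orthonormal 𝕜 v) : ∑ i, ‖T (v i)‖ ^ p ≤ kyFanPowerSum p k T := by
  have hk : k ≤ Module.finrank 𝕜 E := by simpa using hv.linearIndependent.fintype_card_le_finrank
  have hpow : ∀ x : ℝ, 0 ≤ x → (x ^ 2) ^ (p / 2) = x ^ p := fun x hx => by
    rw [← Real.rpow_natCast, ← Real.rpow_mul hx, Nat.cast_ofNat, mul_div_cancel₀ p two_ne_zero]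
  have hmax := sum_map_re_inner_le_sum_map_eigenvalues T.isSymmetric_adjoint_comp_self rfl
    (convexOn_rpow (by linarith : 1 ≤ p / 2))
    (Real.monotoneOn_rpow_Ici_of_exponent_nonneg (by linarith))
    (T.isPositive_adjoint_comp_self.nonneg_eigenvalues rfl) hk hv
  simpa only [kyFanPowerSum, LinearMap.comp_apply, LinearMap.adjoint_inner_left,
    inner_self_eq_norm_sq, ← LinearMap.sq_singularValues_fin, hpow _ (norm_nonneg _),
    hpow _ (T.singularValues_nonneg _), Fin.val_castLE] using hmax

theorem IsTopSingularFamily.kyFanPowerSum_add_mul_kyFanSlope_le {p : ℝ} (hp : 2 ≤ p) {k : ℕ}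
    {T : E →ₗ[𝕜] F} {v : Fin k → E} (hv : IsTopSingularFamily T v) (S : E →ₗ[𝕜] F) :
    kyFanPowerSum p k T + p * kyFanSlope p T S v ≤ kyFanPowerSum p k (T + S) := by
  calc kyFanPowerSum p k T + p * kyFanSlope p T S v
      = ∑ i, (‖T (v i)‖ ^ p + p * (‖T (v i)‖ ^ (p - 2) *
          RCLike.re (inner 𝕜 (T (v i)) (S (v i))))) := by
        rw [Finset.sum_add_distrib, hv.sum_norm_apply_rpow, ← Finset.mul_sum, kyFanSlope]
        simp only [hv.norm_apply]
    _ ≤ ∑ i, ‖(T + S) (v i)‖ ^ p :=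
        Finset.sum_le_sum fun i _ => norm_rpow_add_mul_re_inner_le (by linarith) _ _
    _ ≤ kyFanPowerSum p k (T + S) := sum_norm_apply_rpow_le_kyFanPowerSum (T + S) hp hv.1

theorem kyFanSlope_smul (p : ℝ) {k : ℕ} (T S : E →ₗ[𝕜] F) (t : ℝ) (v : Fin k → E) :
    kyFanSlope p T ((t : 𝕜) • S) v = t * kyFanSlope p T S v := by
  simp only [kyFanSlope, LinearMap.smul_apply, inner_smul_right, RCLike.re_ofReal_mul,
    Finset.mul_sum]
  exact Finset.sum_congr rfl fun i _ => by ring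

theorem kyFanPowerSum_pos {T : E →ₗ[𝕜] F} (hT : T ≠ 0) (p : ℝ) {k : ℕ} (hk : 1 ≤ k) :
    0 < kyFanPowerSum p k T := by
  have hσ : 0 < T.singularValues 0 := by
    rwa [T.singularValues_pos_iff_lt_finrank_range, Module.finrank_pos_iff,
      Submodule.nontrivial_iff_ne_bot, Ne, LinearMap.range_eq_bot]
  exact Finset.sum_pos' (fun i _ => Real.rpow_nonneg (T.singularValues_nonneg i) p)
    ⟨⟨0, hk⟩, Finset.mem_univ _, Real.rpow_pos_of_pos hσ p⟩

theorem continuous_kyFanPowerSum_two {k : ℕ} (hk : k ≤ Module.finrank 𝕜 E) :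
    Continuous fun T : E →L[𝕜] F => kyFanPowerSum 2 k T.toLinearMap := by
  have hsup := (isCompact_setOf_orthonormal 𝕜 E (Fin k)).continuous_sSup
    (f := fun (T : E →L[𝕜] F) v => ∑ i, ‖T (v i)‖ ^ (2 : ℝ))
    (continuous_finsetSum _ fun i _ =>
      Continuous.rpow_const (by fun_prop) fun _ => Or.inr zero_le_two)
  convert hsup using 2 with T
  obtain ⟨v, hv⟩ := exists_isTopSingularFamily T.toLinearMap hk
  have hmax : IsGreatest ((fun v => ∑ i, ‖T (v i)‖ ^ (2 : ℝ)) '' {v : Fin k → E | Orthonormal 𝕜 v})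
      (kyFanPowerSum 2 k T.toLinearMap) :=
    ⟨⟨v, hv.1, hv.sum_norm_apply_rpow 2⟩, Set.forall_mem_image.2 fun _ hw =>
      sum_norm_apply_rpow_le_kyFanPowerSum T.toLinearMap le_rfl hw⟩
  exact hmax.csSup_eq.symm

theorem continuous_singularValues (j : ℕ) :
    Continuous fun T : E →L[𝕜] F => T.toLinearMap.singularValues j := by
  rcases le_or_gt (Module.finrank 𝕜 E) j with hj | hj
  · simpa only [LinearMap.singularValues_of_finrank_le _ hj] using continuous_const
  · -- `σ_{j+1}^2` is the difference of two consecutive power sums with exponent `2`.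
    have hdiff := (continuous_kyFanPowerSum_two (𝕜 := 𝕜) (E := E) (F := F)
      (Nat.succ_le_of_lt hj)).sub (continuous_kyFanPowerSum_two hj.le)
    simp only [kyFanPowerSum, Fin.sum_univ_castSucc, Fin.val_castSucc, Fin.val_last,
      Real.rpow_two] at hdiff
    simpa only [Pi.sub_apply, add_sub_cancel_left,
      Real.sqrt_sq (LinearMap.singularValues_nonneg _ _)] using hdiff.sqrt

theorem isClosed_setOf_isTopSingularFamily (k : ℕ) :
    IsClosed {q : (E →L[𝕜] F) × (Fin k → E) | IsTopSingularFamily q.1.toLinearMap q.2} := by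
  have hσ (j : ℕ) : Continuous fun q : (E →L[𝕜] F) × (Fin k → E) =>
      q.1.toLinearMap.singularValues j := (continuous_singularValues j).comp continuous_fst
  simp only [isTopSingularFamily_iff_inner, Set.ofPred_and, Set.ofPred_forall]
  refine ((isCompact_setOf_orthonormal 𝕜 E (Fin k)).isClosed.preimage continuous_snd).inter
    (isClosed_iInter fun i => isClosed_iInter fun x => isClosed_eq ?_ ?_)
  · simp only [ContinuousLinearMap.coe_coe]
    fun_prop
  · exact (RCLike.continuous_ofReal.comp ((hσ i).pow 2)).mul (by fun_prop)

theorem continuous_kyFanSlope {p : ℝ} (hp : 2 ≤ p) (k : ℕ) (S : E →ₗ[𝕜] F) :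
    Continuous fun q : (E →L[𝕜] F) × (Fin k → E) => kyFanSlope p q.1.toLinearMap S q.2 := by
  have hS := S.continuous_of_finiteDimensional
  refine continuous_finsetSum _ fun i _ => Continuous.mul ?_ ?_
  · exact ((continuous_singularValues i).comp continuous_fst).rpow_const
      fun _ => Or.inr (by linarith)
  · simp only [ContinuousLinearMap.coe_coe]
    fun_prop

theorem exists_isGreatest_hasDerivWithinAt_kyFanPowerSum {p : ℝ} (hp : 2 ≤ p) {k : ℕ}
    (hk : k ≤ Module.finrank 𝕜 E) (T S : E →ₗ[𝕜] F) :
    ∃ d, IsGreatest (kyFanSlope p T S '' {v : Fin k → E | IsTopSingularFamily T v}) d ∧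
      HasDerivWithinAt (fun t : ℝ => kyFanPowerSum p k (T + (t : 𝕜) • S)) (p * d)
        (Set.Ioi 0) 0 := by
  have hp0 : 0 < p := by linarith
  have hpath : Continuous fun q : ℝ × (Fin k → E) =>
      (T.toContinuousLinearMap + (q.1 : 𝕜) • S.toContinuousLinearMap, q.2) :=
    (by fun_prop : Continuous fun t : ℝ =>
      T.toContinuousLinearMap + (t : 𝕜) • S.toContinuousLinearMap).fst'.prodMk continuous_snd
  have hcoe : ∀ t : ℝ, (T.toContinuousLinearMap + (t : 𝕜) • S.toContinuousLinearMap).toLinearMap =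
      T + (t : 𝕜) • S := fun _ => rfl
  have hclosed : IsClosed {q : ℝ × (Fin k → E) | IsTopSingularFamily (T + (q.1 : 𝕜) • S) q.2} := by
    simpa only [Set.preimage_ofPred_eq, hcoe] using
      (isClosed_setOf_isTopSingularFamily k).preimage hpath
  have hslope : Continuous fun q : ℝ × (Fin k → E) => kyFanSlope p (T + (q.1 : 𝕜) • S) S q.2 := by
    simpa only [Function.comp_def, hcoe] using (continuous_kyFanSlope hp k S).comp hpath
  have hsub : ∀ q : ℝ × (Fin k → E), IsTopSingularFamily (T + (q.1 : 𝕜) • S) q.2 → ∀ s : ℝ,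
      kyFanPowerSum p k (T + (q.1 : 𝕜) • S) / p +
        (s - q.1) * kyFanSlope p (T + (q.1 : 𝕜) • S) S q.2 ≤
          kyFanPowerSum p k (T + (s : 𝕜) • S) / p := fun q hq s => by
    have hsubgrad := hq.kyFanPowerSum_add_mul_kyFanSlope_le hp (((s - q.1 : ℝ) : 𝕜) • S)
    rw [kyFanSlope_smul, add_assoc, ← add_smul, ← RCLike.ofReal_add, add_sub_cancel]
      at hsubgrad
    rw [le_div_iff₀ hp0, add_mul, div_mul_cancel₀ _ hp0.ne']
    linarith
  obtain ⟨d, hd, hderiv⟩ := exists_isGreatest_hasDerivWithinAt_Ioi_of_subgradient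
    (f := fun t => kyFanPowerSum p k (T + (t : 𝕜) • S) / p)
    (isCompact_setOf_orthonormal 𝕜 E (Fin k)) hclosed (fun _ hq => hq.1)
    (fun t => exists_isTopSingularFamily (T + (t : 𝕜) • S) hk) hslope hsub 0
  refine ⟨d, by simpa using! hd, ?_⟩
  simpa only [mul_div_cancel₀ _ hp0.ne'] using hderiv.const_mul p

theorem mainTheorem10_general {T : E →ₗ[𝕜] F} (hT : T ≠ 0) (S : E →ₗ[𝕜] F) {p : ℝ} (hp : 2 ≤ p)
    {k : ℕ} (hk1 : 1 ≤ k) (hk : k ≤ Module.finrank 𝕜 E) :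
    ∃ d, HasDerivWithinAt (fun t : ℝ => kyFanPowerSum p k (T + (t : 𝕜) • S) ^ (1 / p)) d
        (Set.Ioi 0) 0 ∧
      IsGreatest {r : ℝ | ∃ v : Fin k → E, IsTopSingularFamily T v ∧
        r = 1 / (kyFanPowerSum p k T ^ (1 / p)) ^ (p - 1) * kyFanSlope p T S v} d := by
  have hc : 0 < kyFanPowerSum p k T := kyFanPowerSum_pos hT p hk1
  obtain ⟨d, hd, hderiv⟩ := exists_isGreatest_hasDerivWithinAt_kyFanPowerSum hp hk T S
  have hcoef : 1 / (kyFanPowerSum p k T ^ (1 / p)) ^ (p - 1) =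
      kyFanPowerSum p k T ^ (1 / p - 1) := by
    rw [← Real.rpow_mul hc.le, one_div, ← Real.rpow_neg hc.le]
    congr 1
    field_simp
    ring
  refine ⟨kyFanPowerSum p k T ^ (1 / p - 1) * d, ?_, ?_⟩
  · convert hderiv.rpow_const (p := 1 / p) (Or.inl (by simpa using hc.ne')) using 1
    simp only [RCLike.ofReal_zero, zero_smul, add_zero]
    field_simp
  · obtain ⟨⟨v, hv, rfl⟩, hub⟩ := hd
    refine ⟨⟨v, hv, by rw [hcoef]⟩, ?_⟩
    rintro _ ⟨w, hw, rfl⟩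
    rw [hcoef]
    gcongr
    exact hub ⟨w, hw, rfl⟩

end SingularValues

section Matrix

variable {m n : ℕ} (A X : Matrix (Fin m) (Fin n) ℂ)

theorem isTopRightSingularFamily_iff {k : ℕ} (v : Fin k → EuclideanSpace ℂ (Fin n)) :
    IsTopRightSingularFamily A v ↔ IsTopSingularFamily (Matrix.toEuclideanLin A) v := by
  simp only [IsTopRightSingularFamily, IsTopSingularFamily, singularValue, Matrix.toLpLin_mul_same,
    LinearMap.comp_apply, Matrix.toEuclideanLin_conjTranspose_eq_adjoint]
  rfl

theorem hasRightDirDerivKyFan_iff (p : ℝ) (k : ℕ) (d : ℝ) :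
    HasRightDirDerivKyFan p k A X d ↔ HasDerivWithinAt (fun t : ℝ => kyFanPowerSum p k
      (Matrix.toEuclideanLin A + (t : ℂ) • Matrix.toEuclideanLin X) ^ (1 / p)) d (Set.Ioi 0) 0 := by
  rw [hasDerivWithinAt_iff_tendsto_slope' Set.self_notMem_Ioi, slope_fun_def_field]
  simp only [HasRightDirDerivKyFan, kyFanNorm, kyFanPowerSum, singularValue, map_add, map_smul,
    Complex.ofReal_zero, zero_smul, add_zero, sub_zero]

end Matrix

theorem mainTheorem10 {m n : ℕ} (A X : Matrix (Fin m) (Fin n) ℂ) (hA : A ≠ 0)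
    (p : ℝ) (hp : 2 ≤ p) (k : ℕ) (hk1 : 1 ≤ k) (hk : k ≤ min m n) :
    ∃ d : ℝ, HasRightDirDerivKyFan p k A X d ∧
      IsGreatest
        {r : ℝ | ∃ v : Fin k → EuclideanSpace ℂ (Fin n), IsTopRightSingularFamily A v ∧
          r = 1 / kyFanNorm p k A ^ (p - 1) *
            ∑ i : Fin k, singularValue A i ^ (p - 2) *
              (inner ℂ (Matrix.toEuclideanLin A (v i)) (Matrix.toEuclideanLin X (v i))).re} d := by
  simp only [isTopRightSingularFamily_iff, hasRightDirDerivKyFan_iff]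
  exact mainTheorem10_general (by simpa using hA) _ hp hk1
    (by simpa using hk.trans (min_le_right m n))
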